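/- Let $X$ be a real Hausdorff locally convex topological vector space, let $K\subseteq X$ be nonempty and convex, and let $Y$ be a compact, convex and symmetric ($-y\in Y$ for all $y\in Y$) subset of a real locally convex topological vector space. Let $U\subseteq K$ be self-segment-dense in $K$, that is, $K\subseteq\overline{U}$ and for all $u,v\in U$ the set $[u,v]\cap U$ is dense in the closed segment $[u,v]$. Let $f:K\times Y\to\mathbb{R}$ be such that (i) for every $y\in Y$, the map $x\mapsto f(x,y)$ is continuous on $K$ and convex on $U$, i.e. $f((1-t)u+tv,y)\le(1-t)f(u,y)+tf(v,y)$ for all $u,v\in U$ and $t\in[0,1]$ with $(1-t)u+tv\in U$; (ii) for every $x\in K$, the map $y\mapsto f(x,y)$ is continuous and affine on $Y$, i.e. $f(x,(1-t)y+tz)=(1-t)f(x,y)+tf(x,z)$ for all $y,z\in Y$ and $t\in[0,1]$. Then $\{f(u,\cdot)\}_{u\in U}$ is dense in $\{f(x,\cdot)\}_{x\in K}\subseteq C(Y)$, where $C(Y)$ is the space of continuous real-valued functions on $Y$ with the topology of the uniform norm. -/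

import Mathlib

/-- `P ⊆ D` is dense in `D`: the closure of `P` contains `D`. -/
def IsDenseIn {α : Type*} [TopologicalSpace α] (P D : Set α) : Prop :=
  P ⊆ D ∧ D ⊆ closure P

/-- `U` is self-segment-dense in `V` (for a convex set `V`): `U` is a dense subset of `V`, and for
all `x, y ∈ U` the set `[x, y] ∩ U` is dense in the closed segment `[x, y]`. -/
def SelfSegmentDense {X : Type*} [AddCommGroup X] [Module ℝ X] [TopologicalSpace X]
    (U V : Set X) : Prop :=
  IsDenseIn U V ∧ ∀ x ∈ U, ∀ y ∈ U, IsDenseIn (segment ℝ x y ∩ U) (segment ℝ x y)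

/-- `g` is convex on the (not necessarily convex) set `U`: the convexity inequality holds for every
convex combination of two points of `U` that lies again in `U`. -/
def ConvexOnPoints {X : Type*} [AddCommGroup X] [Module ℝ X] (U : Set X) (g : X → ℝ) : Prop :=
  ∀ u ∈ U, ∀ v ∈ U, ∀ t ∈ Set.Icc (0 : ℝ) 1, (1 - t) • u + t • v ∈ U →
    g ((1 - t) • u + t • v) ≤ (1 - t) * g u + t * g v

/-- `h` is affine on the convex set `Y`. -/
def AffineOnSet {E : Type*} [AddCommGroup E] [Module ℝ E] (Y : Set E) (h : E → ℝ) : Prop :=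
  ∀ y ∈ Y, ∀ z ∈ Y, ∀ t ∈ Set.Icc (0 : ℝ) 1,
    h ((1 - t) • y + t • z) = (1 - t) * h y + t * h z

/-- For `x ∈ K`, the function `f(x, ·)` as an element of the space `C(Y)` of continuous real
functions on `Y`. For compact `Y`, the topology of `C(Y, ℝ)` is that of the uniform norm. -/
def sectionInC {X E : Type*} [TopologicalSpace E] {K : Set X} {Y : Set E} (f : X → E → ℝ)
    (hf : ∀ x ∈ K, ContinuousOn (f x) Y) (x : K) : C(Y, ℝ) :=
  ⟨Y.domRestrict (f x), (hf x x.2).domRestrict⟩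

theorem SelfSegmentDense.exists_combo_mem {X : Type*} [AddCommGroup X] [Module ℝ X]
    [TopologicalSpace X] [IsTopologicalAddGroup X] [ContinuousSMul ℝ X] [T2Space X]
    {U K : Set X} (hU : SelfSegmentDense U K) {u v : X} (hu : u ∈ U) (hv : v ∈ U)
    {b : ℝ} (hb : b ∈ Set.Icc (0 : ℝ) 1) {η : ℝ} (hη : 0 < η) :
    ∃ s ∈ Set.Icc (0 : ℝ) 1, |s - b| < η ∧ (1 - s) • u + s • v ∈ U := by
  rcases eq_or_ne u v with rfl | huv
  · exact ⟨b, hb, by simpa using hη, by rwa [← add_smul, sub_add_cancel, one_smul]⟩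
  set L : ℝ → X := fun s => (1 - s) • u + s • v with hL
  have hLcont : Continuous L := by fun_prop
  have hLinj : Function.Injective L := by
    intro s t hst
    have h : (s - t) • (v - u) = 0 := by
      have h' : L s - L t = 0 := sub_eq_zero.2 hst
      rw [← h', hL]
      module
    rcases smul_eq_zero.1 h with h | h
    · exact sub_eq_zero.1 h
    · exact absurd (sub_eq_zero.1 h).symm huv
  set A : Set ℝ := Set.Icc 0 1 ∩ {s | η ≤ |s - b|} with hA
  have hAcomp : IsCompact A :=
    isCompact_Icc.inter_right (isClosed_le continuous_const (by fun_prop))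
  have hbA : L b ∉ L '' A := by
    rintro ⟨s, hs, hsb⟩
    have := hs.2
    rw [hLinj hsb] at this
    simp only [Set.mem_ofPred_eq, sub_self, abs_zero] at this
    linarith
  have hLb : L b ∈ closure (segment ℝ u v ∩ U) :=
    (hU.2 u hu v hv).2 ⟨1 - b, b, by linarith [hb.2], hb.1, by ring, rfl⟩
  obtain ⟨w, hwA, ⟨c, s, hc, hs, hcs, rfl⟩, hwU⟩ :=
    mem_closure_iff.1 hLb _ (hAcomp.image hLcont).isClosed.isOpen_compl hbA
  obtain rfl : c = 1 - s := by linarith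
  have hs1 : s ∈ Set.Icc (0 : ℝ) 1 := ⟨hs, by linarith⟩
  refine ⟨s, hs1, ?_, hwU⟩
  by_contra! h
  exact hwA ⟨s, ⟨hs1, h⟩, rfl⟩

/-- A minimax principle for a family of continuous affine functions on a compact convex set that is
approximately convex-like in its parameter: if the values can be pushed below `t` at each point,
then they can be pushed below any `t' > t` uniformly. -/
theorem exists_forall_lt_of_forall_exists_lt {ι E : Type*} [AddCommGroup E] [Module ℝ E]
    [TopologicalSpace E] [IsTopologicalAddGroup E] [ContinuousSMul ℝ E]
    {Y : Set E} (hYcomp : IsCompact Y) (hYconv : Convex ℝ Y) (hYne : Y.Nonempty)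
    {V : Set ι} {F : ι → E → ℝ}
    (haff : ∀ u ∈ V, AffineOnSet Y (F u)) (hcont : ∀ u ∈ V, ContinuousOn (F u) Y)
    (hlike : ∀ u ∈ V, ∀ v ∈ V, ∀ b ∈ Set.Icc (0 : ℝ) 1, ∀ δ > 0,
      ∃ w ∈ V, ∀ y ∈ Y, F w y ≤ (1 - b) * F u y + b * F v y + δ)
    {t t' : ℝ} (htt' : t < t') (hlt : ∀ y ∈ Y, ∃ u ∈ V, F u y < t) :
    ∃ u ∈ V, ∀ y ∈ Y, F u y < t' := by
  set T : Set (E → ℝ) := {h | AffineOnSet Y h ∧ ContinuousOn h Y ∧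
    ∀ δ > 0, ∃ u ∈ V, ∀ y ∈ Y, F u y ≤ h y + δ} with hT
  have hFT : ∀ u ∈ V, F u ∈ T := fun u hu =>
    ⟨haff u hu, hcont u hu, fun δ hδ => ⟨u, hu, fun y _ => by linarith⟩⟩
  have hTconv : Convex ℝ T := by
    rintro h₁ ⟨ha₁, hc₁, hd₁⟩ h₂ ⟨ha₂, hc₂, hd₂⟩ a b ha hb hab
    obtain rfl : a = 1 - b := by linarith
    refine ⟨fun y hy z hz s hs => ?_, (hc₁.const_smul _).add (hc₂.const_smul _),
      fun δ hδ => ?_⟩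
    · simp only [Pi.add_apply, Pi.smul_apply, smul_eq_mul, ha₁ y hy z hz s hs,
        ha₂ y hy z hz s hs]
      ring
    · obtain ⟨u, hu, hu'⟩ := hd₁ (δ / 2) (by linarith)
      obtain ⟨v, hv, hv'⟩ := hd₂ (δ / 2) (by linarith)
      obtain ⟨w, hw, hw'⟩ := hlike u hu v hv b ⟨hb, by linarith⟩ (δ / 2) (by linarith)
      refine ⟨w, hw, fun y hy => ?_⟩
      simp only [Pi.add_apply, Pi.smul_apply, smul_eq_mul]
      have h1 := mul_le_mul_of_nonneg_left (hu' y hy) ha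
      have h2 := mul_le_mul_of_nonneg_left (hv' y hy) hb
      linarith [hw' y hy]
  have hquasi : ∀ h ∈ T, QuasiconvexOn ℝ Y fun y => -h y := by
    intro h hh
    refine ConvexOn.quasiconvexOn ⟨hYconv, fun y hy z hz a b ha hb hab => ?_⟩
    obtain rfl : a = 1 - b := by linarith
    simp only [hh.1 y hy z hz b ⟨hb, by linarith⟩, smul_eq_mul]
    linarith
  have hquasi' : ∀ y ∈ Y, QuasiconcaveOn ℝ T fun h => -h y := by
    intro y _
    refine ConcaveOn.quasiconcaveOn ⟨hTconv, fun h₁ _ h₂ _ a b _ _ _ => ?_⟩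
    simp only [Pi.add_apply, Pi.smul_apply, smul_eq_mul]
    linarith
  have hlsc : ∀ h ∈ T, LowerSemicontinuousOn (fun y => -h y) Y := fun h hh =>
    hh.2.1.neg.lowerSemicontinuousOn
  have husc : ∀ y ∈ Y, UpperSemicontinuousOn (fun h : E → ℝ => -h y) T := fun y _ =>
    ((continuous_apply y).neg.continuousOn).upperSemicontinuousOn
  obtain ⟨s, hs⟩ : ∃ s : Finset T, ∀ y ∈ Y, ∃ i ∈ s, -t < -(i : E → ℝ) y := by
    rw [← LowerSemicontinuousOn.inter_biInter_preimage_Iic_eq_empty_iff_exists_finset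
      (f := fun (h : E → ℝ) y => -h y) hYcomp hlsc]
    refine Set.eq_empty_of_forall_notMem ?_
    rintro y ⟨hy, hy'⟩
    obtain ⟨u, hu, hut⟩ := hlt y hy
    simp only [Set.mem_iInter, Set.mem_preimage, Set.mem_Iic] at hy'
    have := hy' (F u) (hFT u hu)
    linarith
  obtain ⟨h, hh, hht⟩ := Sion.exists_lt_iInf_of_lt_iInf_of_finite (f := fun y (h : E → ℝ) => -h y)
    hYne hYcomp hlsc hquasi hTconv husc hquasi' hYconv
    (t := -t) (s := Subtype.val '' (s : Set T)) (Set.toFinite _) (Subtype.coe_image_subset T _)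
    (fun y hy => by
      obtain ⟨i, hi, hi'⟩ := hs y hy
      exact ⟨i, ⟨i, hi, rfl⟩, hi'⟩)
  obtain ⟨u, hu, hu'⟩ := hh.2.2 (t' - t) (by linarith)
  exact ⟨u, hu, fun y hy => by linarith [hu' y hy, hht y hy]⟩

theorem theorem5p2
    {X : Type*} [AddCommGroup X] [Module ℝ X] [TopologicalSpace X] [IsTopologicalAddGroup X]
    [ContinuousSMul ℝ X] [LocallyConvexSpace ℝ X] [T2Space X]
    {E : Type*} [AddCommGroup E] [Module ℝ E] [TopologicalSpace E] [IsTopologicalAddGroup E]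
    [ContinuousSMul ℝ E] [LocallyConvexSpace ℝ E]
    (K : Set X) (hKne : K.Nonempty) (hKconv : Convex ℝ K)
    (Y : Set E) (hYcomp : IsCompact Y) (hYconv : Convex ℝ Y) (hYsymm : ∀ y ∈ Y, -y ∈ Y)
    (U : Set X) (hU : SelfSegmentDense U K)
    (f : X → E → ℝ)
    (hconvex : ∀ y ∈ Y, ConvexOnPoints U (fun x => f x y))
    (hcontK : ∀ y ∈ Y, ContinuousOn (fun x => f x y) K)
    (haffine : ∀ x ∈ K, AffineOnSet Y (f x))
    (hcontY : ∀ x ∈ K, ContinuousOn (f x) Y) :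
    IsDenseIn (sectionInC f hcontY '' {x : K | (x : X) ∈ U})
      (Set.range (sectionInC f hcontY)) := by
  have hUK : U ⊆ K := hU.1.1
  refine ⟨?_, ?_⟩
  · rintro _ ⟨x, -, rfl⟩
    exact ⟨x, rfl⟩
  rintro _ ⟨⟨x₀, hx₀⟩, rfl⟩
  have : CompactSpace Y := isCompact_iff_compactSpace.1 hYcomp
  have hx₀U : x₀ ∈ closure U := hU.1.2 hx₀
  rcases Y.eq_empty_or_nonempty with rfl | hYne
  · obtain ⟨u, hu⟩ := closure_nonempty_iff.1 ⟨x₀, hx₀U⟩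
    refine subset_closure ⟨⟨u, hUK hu⟩, hu, ?_⟩
    ext y
    exact y.2.elim
  have hY0 : (0 : E) ∈ Y := by
    obtain ⟨y, hy⟩ := hYne
    have := hYconv hy (hYsymm y hy) (a := 1 / 2) (b := 1 / 2) (by norm_num) (by norm_num)
      (by norm_num)
    simpa using this
  have hbound : ∀ x ∈ K, ∃ C, ∀ y ∈ Y, |f x y| ≤ C := fun x hx =>
    hYcomp.exists_bound_of_continuousOn (hcontY x hx)
  rw [Metric.mem_closure_iff]
  intro ε hε
  have hcw : ∀ y ∈ Y, ContinuousWithinAt (fun x => f x y) U x₀ := fun y hy =>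
    (hcontK y hy x₀ hx₀).mono hUK
  obtain ⟨N, ⟨hN, hNconv⟩, hNlow⟩ : ∃ N, (N ∈ nhds x₀ ∧ Convex ℝ N) ∧
      ∀ x ∈ N ∩ U, f x₀ 0 - ε / 8 < f x 0 := by
    have h : {x | f x₀ 0 - ε / 8 < f x 0} ∈ nhdsWithin x₀ U :=
      (hcw 0 hY0).eventually (lt_mem_nhds (by linarith))
    obtain ⟨M, hM, hMsub⟩ := mem_nhdsWithin_iff_exists_mem_nhds_inter.1 h
    obtain ⟨N, hN, hNM⟩ := (LocallyConvexSpace.convex_basis (𝕜 := ℝ) x₀).mem_iff.1 hM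
    exact ⟨N, hN, fun x hx => hMsub ⟨hNM hx.1, hx.2⟩⟩
  obtain ⟨u, hu, hup⟩ := exists_forall_lt_of_forall_exists_lt hYcomp hYconv hYne
    (V := N ∩ U) (F := fun x y => f x y - f x₀ y) (t := ε / 8) (t' := ε / 4)
    (fun x hx y hy z hz t ht => by
      simp only [haffine x (hUK hx.2) y hy z hz t ht, haffine x₀ hx₀ y hy z hz t ht]
      ring)
    (fun x hx => (hcontY x (hUK hx.2)).sub (hcontY x₀ hx₀))
    (by
      intro v hv w hw b hb δ hδ
      obtain ⟨C, hC⟩ := hbound v (hUK hv.2)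
      obtain ⟨D, hD⟩ := hbound w (hUK hw.2)
      have hCD : 0 ≤ C + D := add_nonneg ((abs_nonneg _).trans (hC 0 hY0))
        ((abs_nonneg _).trans (hD 0 hY0))
      obtain ⟨s, hs, hsb, hsU⟩ := hU.exists_combo_mem hv.2 hw.2 hb
        (η := δ / (C + D + 1)) (by positivity)
      refine ⟨_, ⟨hNconv hv.1 hw.1 (by linarith [hs.2]) hs.1 (by ring), hsU⟩, fun y hy => ?_⟩
      have hcv := hconvex y hy v hv.2 w hw.2 s hs hsU
      have hd : (s - b) * (f w y - f v y) ≤ δ := by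
        calc (s - b) * (f w y - f v y) ≤ |s - b| * |f w y - f v y| := by
              rw [← abs_mul]; exact le_abs_self _
          _ ≤ δ / (C + D + 1) * (C + D + 1) := by
              gcongr
              linarith [abs_sub (f w y) (f v y), hC y hy, hD y hy]
          _ = δ := by field_simp
      simp only at hcv ⊢
      linarith)
    (by linarith)
    (fun y hy => by
      have h : ∀ᶠ x in nhdsWithin x₀ U, f x y < f x₀ y + ε / 8 :=
        (hcw y hy).eventually (gt_mem_nhds (by linarith))
      have : (nhdsWithin x₀ U).NeBot := mem_closure_iff_nhdsWithin_neBot.1 hx₀U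
      obtain ⟨x, ⟨hx, hxN⟩, hxU⟩ :=
        ((h.and (mem_nhdsWithin_of_mem_nhds hN)).and self_mem_nhdsWithin).exists
      exact ⟨x, ⟨hxN, hxU⟩, by linarith⟩)
  refine ⟨_, ⟨⟨u, hUK hu.2⟩, hu.2, rfl⟩, ?_⟩
  have hmid : ∀ x ∈ K, ∀ y ∈ Y, f x y + f x (-y) = 2 * f x 0 := by
    intro x hx y hy
    have h := haffine x hx y hy (-y) (hYsymm y hy) (1 / 2) ⟨by norm_num, by norm_num⟩
    rw [show (1 - 1 / 2 : ℝ) • y + (1 / 2 : ℝ) • -y = 0 by module] at h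
    linarith
  rw [ContinuousMap.dist_lt_iff hε]
  rintro ⟨y, hy⟩
  change dist (f x₀ y) (f u y) < ε
  rw [Real.dist_eq, abs_sub_lt_iff]
  have h1 := hup y hy
  have h2 := hup (-y) (hYsymm y hy)
  have h3 := hNlow u hu
  have h4 := hmid x₀ hx₀ y hy
  have h5 := hmid u (hUK hu.2) y hy
  constructor <;> linarith
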